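/- Consider a private requeueing problem $(N,m_0,\sigma_0,w,b)$. Here $N=\{1,\dots,n\}$ is a set of agents with unit waiting costs $w_1\ge w_2\ge\dots\ge w_n>0$, $b\ge 0$ is the cost of a machine, and a scheduling plan consists of $m\ge 1$ machines and a schedule $\sigma=(\varphi,s)$ assigning to each agent $i$ a machine $\varphi(i)$ and a starting time $s(i)\in\{0,1,2,\dots\}$, such that two different agents on the same machine have different starting times. The existing plan is $(m_0,\sigma_0)$ with $\sigma_0=(\varphi_0,s_0)$. The waiting cost of a coalition $T\subseteq N$ is $c_\sigma(T)=\sum_{i\in T}w_i(s(i)+1)$. A plan is admissible for $T$ with swaps if every $i\in N\setminus T$ stays on its machine and satisfies $s(i)\le s_0(i)$. It is admissible for $T$ without swaps if every $i\in N\setminus T$ stays on its machine and all agents processed before $i$ on that machine were already processed before $i$ on it under $\sigma_0$. (In particular a machine can be sold only if all its users belong to $T$, and new machines are used only by $T$.) The value $V_s(T)$ (with swaps), respectively $V_{ns}(T)$ (without swaps), is the maximum of $c_{\sigma_0}(T)-c_\sigma(T)-(m-m_0)b$ over the plans $(m,\sigma)$ admissible for $T$ in the respective sense. The core of a game $V$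 is $$\mathrm{Core}(V)=\Bigl\{y\in\mathbb{R}^N : \sum_{i\in N}y_i=V(N),\ \sum_{i\in S}y_i\ge V(S)\text{ for all }S\subseteq N\Bigr\}.$$ Suppose that $m_0=1$, that the existing queue is semi-active (it has no idle time, so its starting times are exactly $0,1,\dots,n-1$), and that $$b\ \ge\ \sum_{k=1}^{\mu}(n-k)\,w_k,\qquad \mu=\left\lceil \tfrac n2\right\rceil .$$ Then, both with and without swaps, no coalition gains from buying a machine, that is, every coalition $T\subseteq N$ has an optimal admissible plan that uses only the existing machine; and $\mathrm{Core}(V_s)\neq\emptyset$ and $\mathrm{Core}(V_{ns})\neq\emptyset$. -/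

import Mathlib

/-- A scheduling plan for the agents `Fin n`: a finite nonempty set of active machines (machines carry
natural number labels), the machine `machine i` on which agent `i` is processed and the time
`start i` at which its job starts. Two different agents on one machine have different starting
times. -/
structure SchedulingPlan (n : ℕ) where
  machines : Finset ℕ
  machines_nonempty : machines.Nonempty
  machine : Fin n → ℕ
  machine_mem : ∀ i, machine i ∈ machines
  start : Fin n → ℕ
  admissible : ∀ i j, i ≠ j → machine i = machine j → start i ≠ start j

namespace SchedulingPlan

variable {n : ℕ}

/-- The number `m` of machines of a plan. -/
def numMachines (p : SchedulingPlan n) : ℕ := p.machines.card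

/-- The set of agents assigned to machine `k`. -/
def users (p : SchedulingPlan n) (k : ℕ) : Finset (Fin n) :=
  Finset.univ.filter (fun i => p.machine i = k)

/-- The agents processed before agent `i` on the machine of `i`. -/
def predecessors (p : SchedulingPlan n) (i : Fin n) : Set (Fin n) :=
  {l | p.machine l = p.machine i ∧ p.start l < p.start i}

/-- A semi-active schedule: no machine has downtime before one of its jobs, and the numbers of
agents on two active machines differ by at most one. -/
def SemiActive (p : SchedulingPlan n) : Prop :=
  (∀ i, ∀ t < p.start i, ∃ j, p.machine j = p.machine i ∧ p.start j = t) ∧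
  (∀ k ∈ p.machines, ∀ k' ∈ p.machines, (p.users k).card < (p.users k').card + 2)

end SchedulingPlan

/-- A requeueing problem with an endogenous number of machines: the existing plan `(m₀, σ₀)`, the
unit waiting costs `w` (agents are numbered by decreasing waiting cost) and the machine cost `b`. -/
structure RequeueingProblem (n : ℕ) where
  initial : SchedulingPlan n
  w : Fin n → ℝ
  b : ℝ
  w_pos : ∀ i, 0 < w i
  w_antitone : Antitone w
  b_nonneg : 0 ≤ b

namespace RequeueingProblem

variable {n : ℕ}

/-- The total waiting cost of the members of `T` under the plan `p`; the job of `i` is completed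
at time `p.start i + 1`. -/
def waitingCost (P : RequeueingProblem n) (p : SchedulingPlan n) (T : Finset (Fin n)) : ℝ :=
  ∑ i ∈ T, P.w i * ((p.start i : ℝ) + 1)

/-- The cost savings of coalition `T` if it moves from the existing plan to the plan `p`: it pays
`b` for each additional machine and recovers `b` for each machine sold. -/
def savings (P : RequeueingProblem n) (T : Finset (Fin n)) (p : SchedulingPlan n) : ℝ :=
  P.waitingCost P.initial T - P.waitingCost p T
    - ((p.numMachines : ℝ) - (P.initial.numMachines : ℝ)) * P.b

/-- Plans admissible for `T` without swaps: agents outside `T` stay on their machine (so a machine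
is sold only if all its users are in `T`, and new machines are used by `T` only) and have no new
predecessors. -/
def AdmissibleNoSwaps (P : RequeueingProblem n) (T : Finset (Fin n)) (p : SchedulingPlan n) : Prop :=
  ∀ i, i ∉ T → p.machine i = P.initial.machine i ∧ p.predecessors i ⊆ P.initial.predecessors i

/-- Plans admissible for `T` with swaps: agents outside `T` stay on their machine and do not start
later than before. -/
def AdmissibleSwaps (P : RequeueingProblem n) (T : Finset (Fin n)) (p : SchedulingPlan n) : Prop :=
  ∀ i, i ∉ T → p.machine i = P.initial.machine i ∧ p.start i ≤ P.initial.start i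

/-- The private requeueing game without swaps: the maximal savings of each coalition. -/
noncomputable def gameNoSwaps (P : RequeueingProblem n) (T : Finset (Fin n)) : ℝ :=
  sSup (P.savings T '' {p | P.AdmissibleNoSwaps T p})

/-- The private requeueing game with swaps: the maximal savings of each coalition. -/
noncomputable def gameSwaps (P : RequeueingProblem n) (T : Finset (Fin n)) : ℝ :=
  sSup (P.savings T '' {p | P.AdmissibleSwaps T p})

/-- The bound `∑_{k=1}^{μ} (n - k) w_k` with `μ = ⌈n / 2⌉`; agent `k` of the usual numbering is the
element `i` of `Fin n` with `i + 1 = k`. -/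
noncomputable def machineCostBound (P : RequeueingProblem n) : ℝ :=
  ∑ i ∈ Finset.univ.filter (fun i : Fin n => (i : ℕ) + 1 ≤ ⌈(n : ℚ) / 2⌉₊),
    ((n : ℝ) - ((i : ℕ) + 1 : ℝ)) * P.w i

end RequeueingProblem

/-- The core of a game `v` of values: efficient allocations that give every coalition at least its
value. -/
def valueCore {n : ℕ} (v : Finset (Fin n) → ℝ) : Set (Fin n → ℝ) :=
  {y | ∑ i, y i = v Finset.univ ∧ ∀ S : Finset (Fin n), v S ≤ ∑ i ∈ S, y i}

/-! ### Merging all machines into one queue -/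

namespace SchedulingPlan

variable {n : ℕ}

/-! Extra machines never pay. Put the users of the machine serving the outsiders first and append
the other machines one after another. The first group is not delayed, and a user of a machine with
user set `R` is delayed by at most `n - |R|`. So giving up that machine costs its users at most `∑ i
∈ R, w i * (n - |R|)`, which `sum_card_compl_mul_le_machineCostBound` bounds by `b`. This is
`exists_consolidated`.

What remains is an exchange economy with the slots `0, …, n - 1` of one queue as goods. The prices
`slotPrice` support the sorted queue (`cost_own_slot_le`), and the competitive allocation is in the
core: outsiders only move to earlier, hence no cheaper, slots, so a coalition's new slots are worth
at most its initial ones. Both games share this core element. -/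

theorem ncard_predecessors_le_start (p : SchedulingPlan n) (i : Fin n) :
    (p.predecessors i).ncard ≤ p.start i := by
  have h : (p.predecessors i).ncard ≤ (Set.Iio (p.start i)).ncard := by
    refine Set.ncard_le_ncard_of_injOn p.start (fun l hl => hl.2) ?_ (Set.finite_Iio _)
    intro a ha b hb hab
    by_contra hne
    exact p.admissible a b hne (ha.1.trans hb.1.symm) hab
  simpa [Set.ncard_eq_toFinset_card'] using h

/-- The machines are processed one after the other, starting with machine `k`: an agent is ordered
by the position of its machine and then by its starting time. -/
def priority (p : SchedulingPlan n) (k : ℕ) (i : Fin n) : ℕ ×ₗ ℕ :=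
  -- The shift by one reserves position `0` for machine `k`.
  toLex (if p.machine i = k then 0 else p.machine i + 1, p.start i)

theorem priority_injective (p : SchedulingPlan n) (k : ℕ) :
    Function.Injective (p.priority k) := by
  intro i j h
  have h' := toLex.injective h
  rw [Prod.mk.injEq] at h'
  by_contra hne
  refine p.admissible i j hne ?_ h'.2
  have h1 := h'.1
  split_ifs at h1 <;> omega

theorem priority_lt_iff_of_machine_eq (p : SchedulingPlan n) {k : ℕ} {i : Fin n}
    (hi : p.machine i = k) (j : Fin n) :
    p.priority k j < p.priority k i ↔ p.machine j = p.machine i ∧ p.start j < p.start i := by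
  rw [priority, priority, Prod.Lex.toLex_lt_toLex, if_pos hi, hi]
  by_cases hj : p.machine j = k <;> simp [hj]

theorem priority_lt_iff_of_machine_eq_machine (p : SchedulingPlan n) {k : ℕ} {i j : Fin n}
    (hij : p.machine j = p.machine i) :
    p.priority k j < p.priority k i ↔ p.start j < p.start i := by
  rw [priority, priority, Prod.Lex.toLex_lt_toLex, hij]
  simp

/-- All agents are served by machine `M`, in the order given by `priority k`. -/
noncomputable def consolidate (p : SchedulingPlan n) (k M : ℕ) : SchedulingPlan n where
  machines := {M}
  machines_nonempty := Finset.singleton_nonempty M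
  machine := fun _ => M
  machine_mem := fun _ => Finset.mem_singleton_self M
  start := fun i => (Finset.univ.filter (fun j => p.priority k j < p.priority k i)).card
  admissible := by
    have key : ∀ i j : Fin n, p.priority k i < p.priority k j →
        (Finset.univ.filter (fun l => p.priority k l < p.priority k i)).card <
        (Finset.univ.filter (fun l => p.priority k l < p.priority k j)).card := by
      intro i j hij
      refine Finset.card_lt_card (Finset.ssubset_iff_of_subset ?_ |>.2 ⟨i, by simpa, by simp⟩)
      intro l hl
      simp only [Finset.mem_filter, Finset.mem_univ, true_and] at hl ⊢
      exact hl.trans hij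
    intro i j hij _
    rcases lt_or_gt_of_ne ((p.priority_injective k).ne hij) with h | h
    · exact (key i j h).ne
    · exact (key j i h).ne'

theorem consolidate_start_lt (p : SchedulingPlan n) (k M : ℕ) (i : Fin n) :
    (p.consolidate k M).start i < n := by
  have h : (Finset.univ.filter (fun j => p.priority k j < p.priority k i)).card <
      (Finset.univ : Finset (Fin n)).card :=
    Finset.card_lt_card (Finset.filter_ssubset.2 ⟨i, Finset.mem_univ i, lt_irrefl _⟩)
  simpa [consolidate] using h

theorem consolidate_start_lt_iff (p : SchedulingPlan n) (k M : ℕ) (i j : Fin n) :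
    (p.consolidate k M).start j < (p.consolidate k M).start i ↔
      p.priority k j < p.priority k i := by
  have mono : ∀ i j : Fin n, p.priority k i ≤ p.priority k j →
      (p.consolidate k M).start i ≤ (p.consolidate k M).start j := by
    intro i j hij
    simp only [consolidate]
    refine Finset.card_le_card fun l hl => ?_
    simp only [Finset.mem_filter, Finset.mem_univ, true_and] at hl ⊢
    exact hl.trans_le hij
  constructor
  · intro h
    by_contra hle
    exact absurd (mono i j (not_lt.1 hle)) (not_le.2 h)
  · intro h
    refine lt_of_le_of_ne (mono j i h.le) ((p.consolidate k M).admissible j i ?_ rfl)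
    rintro rfl
    exact lt_irrefl _ h

theorem consolidate_predecessors (p : SchedulingPlan n) {k : ℕ} (M : ℕ) {i : Fin n}
    (hi : p.machine i = k) : (p.consolidate k M).predecessors i = p.predecessors i := by
  ext j
  change _ ∧ _ ↔ _ ∧ _
  rw [consolidate_start_lt_iff, p.priority_lt_iff_of_machine_eq hi]
  exact and_iff_right rfl

/-- Machine `k` comes first, so its users wait only for their old predecessors, and idle time
disappears. -/
theorem consolidate_start_eq (p : SchedulingPlan n) {k : ℕ} (M : ℕ) {i : Fin n}
    (hi : p.machine i = k) : (p.consolidate k M).start i = (p.predecessors i).ncard := by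
  rw [predecessors, Set.ncard_eq_toFinset_card']
  simp only [consolidate, p.priority_lt_iff_of_machine_eq hi]
  congr 1
  ext j
  simp

/-- Whoever is now ahead of `i` either preceded it on its own machine or used another machine. -/
theorem consolidate_start_le (p : SchedulingPlan n) (k M : ℕ) (i : Fin n) :
    (p.consolidate k M).start i ≤ p.start i + (n - (p.users (p.machine i)).card) := by
  have hsub : Finset.univ.filter (fun j => p.priority k j < p.priority k i) ⊆
      (p.predecessors i).toFinite.toFinset ∪ (p.users (p.machine i))ᶜ := by
    intro j hj
    simp only [Finset.mem_filter, Finset.mem_univ, true_and] at hj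
    by_cases hji : p.machine j = p.machine i
    · exact Finset.mem_union_left _ ((Set.Finite.mem_toFinset _).2
        ⟨hji, (p.priority_lt_iff_of_machine_eq_machine hji).1 hj⟩)
    · exact Finset.mem_union_right _ (by simp [users, hji])
  calc (p.consolidate k M).start i ≤ _ := Finset.card_le_card hsub
    _ ≤ _ := Finset.card_union_le _ _
    _ ≤ _ := by
      rw [Finset.card_compl, Fintype.card_fin, ← Set.ncard_eq_toFinset_card]
      exact Nat.add_le_add_right (p.ncard_predecessors_le_start i) _

end SchedulingPlan

/-! ### The loss from giving up one machine -/

theorem sum_le_sum_of_antitone_initial {n : ℕ} {w : Fin n → ℝ} (hw : Antitone w)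
    (R : Finset (Fin n)) :
    ∑ i ∈ R, w i ≤ ∑ i ∈ Finset.univ.filter (fun i : Fin n => (i : ℕ) < R.card), w i := by
  set A := Finset.univ.filter (fun i : Fin n => (i : ℕ) < R.card) with hA
  have hRn : R.card ≤ n := by simpa using R.card_le_univ
  have hAcard : A.card = R.card := by
    rw [hA, Fin.card_filter_val_lt, min_eq_right hRn]
  rcases Nat.eq_zero_or_pos R.card with h0 | hpos
  · rw [Finset.card_eq_zero.1 h0, Finset.card_eq_zero.1 (hAcard.trans h0)]
  -- The weight at the cutoff separates `R \ A` from `A \ R`, two sets of equal size.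
  · set c := w ⟨R.card - 1, by omega⟩ with hc
    have h1 : ∑ i ∈ R \ A, w i ≤ (R \ A).card • c := by
      refine Finset.sum_le_card_nsmul _ _ _ fun i hi => hw ?_
      simp only [hA, Finset.mem_sdiff, Finset.mem_filter, Finset.mem_univ, true_and] at hi
      rw [Fin.le_def]
      simp only
      omega
    have h2 : (A \ R).card • c ≤ ∑ i ∈ A \ R, w i := by
      refine Finset.card_nsmul_le_sum _ _ _ fun i hi => hw ?_
      simp only [hA, Finset.mem_sdiff, Finset.mem_filter, Finset.mem_univ, true_and] at hi
      rw [Fin.le_def]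
      simp only
      omega
    rw [Finset.card_sdiff_comm hAcard] at h2
    rw [← Finset.sum_inter_add_sum_sdiff R A, ← Finset.sum_inter_add_sum_sdiff A R,
      Finset.inter_comm A R]
    linarith

namespace RequeueingProblem

variable {n : ℕ} (P : RequeueingProblem n)

/-- The worst `R` of size `r` consists of the `r` most impatient agents. If `r ≤ μ`, compare
termwise, since `n - r ≤ n - k` for `k ≤ r`. If `r ≥ μ`, the slack in the first `μ` terms pays for
the `r - μ` further agents. -/
theorem sum_card_compl_mul_le_machineCostBound (R : Finset (Fin n)) :
    ∑ i ∈ R, P.w i * ((n : ℝ) - R.card) ≤ P.machineCostBound := by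
  have hRn : R.card ≤ n := by simpa using R.card_le_univ
  have hRn' : (R.card : ℝ) ≤ n := by exact_mod_cast hRn
  obtain ⟨μ, hμ⟩ : ∃ μ, μ = ⌈(n : ℚ) / 2⌉₊ := ⟨_, rfl⟩
  have hμn : n ≤ 2 * μ := by
    have h : (n : ℚ) / 2 ≤ μ := hμ ▸ Nat.le_ceil _
    have h' : (n : ℚ) ≤ 2 * μ := by linarith
    exact_mod_cast h'
  have hμle : μ ≤ n := by
    rw [hμ]
    refine Nat.ceil_le.2 ?_
    have : (0 : ℚ) ≤ n := Nat.cast_nonneg n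
    linarith
  rw [machineCostBound, ← hμ, ← Finset.sum_mul]
  simp only [Nat.succ_le_iff]
  refine (mul_le_mul_of_nonneg_right (sum_le_sum_of_antitone_initial P.w_antitone R)
    (sub_nonneg.2 hRn')).trans ?_
  rw [Finset.sum_mul]
  set r := R.card with hr
  rcases le_total r μ with hle | hle
  · refine (Finset.sum_le_sum fun i hi => ?_).trans
      (Finset.sum_le_sum_of_subset_of_nonneg (f := fun i : Fin n =>
        ((n : ℝ) - ((i : ℕ) + 1 : ℝ)) * P.w i)
        (Finset.monotone_filter_right _ fun i _ (hi : (i : ℕ) < r) => hi.trans_le hle) ?_)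
    · have hi' : ((i : ℕ) : ℝ) + 1 ≤ r := by exact_mod_cast (Finset.mem_filter.1 hi).2
      rw [mul_comm]
      exact mul_le_mul_of_nonneg_right (by linarith) (P.w_pos i).le
    · intro i _ _
      have hi' : ((i : ℕ) : ℝ) + 1 ≤ n := by exact_mod_cast i.2
      exact mul_nonneg (by linarith) (P.w_pos i).le
  · rcases Nat.eq_zero_or_pos μ with h0 | hpos
    · have : n = 0 := by omega
      subst this
      simp
    · set c := P.w ⟨μ - 1, by omega⟩ with hc
      have hc0 : 0 < c := P.w_pos _
      set A := Finset.univ.filter (fun i : Fin n => (i : ℕ) < μ) with hA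
      set B := Finset.univ.filter (fun i : Fin n => (i : ℕ) < r) with hB
      have hAB : A ⊆ B :=
        Finset.monotone_filter_right _ fun i _ (hi : (i : ℕ) < μ) => hi.trans_le hle
      have hAcard : A.card = μ := by rw [hA, Fin.card_filter_val_lt, min_eq_right hμle]
      have hBcard : B.card = r := by rw [hB, Fin.card_filter_val_lt, min_eq_right hRn]
      have hle' : (μ : ℝ) ≤ r := by exact_mod_cast hle
      have h1 : ∑ i ∈ B \ A, P.w i * ((n : ℝ) - r) ≤ (B \ A).card • (c * ((n : ℝ) - r)) := by
        refine Finset.sum_le_card_nsmul _ _ _ fun i hi =>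
          mul_le_mul_of_nonneg_right (P.w_antitone ?_) (sub_nonneg.2 hRn')
        simp only [hA, Finset.mem_sdiff, Finset.mem_filter, Finset.mem_univ, true_and] at hi
        rw [Fin.le_def]
        simp only
        omega
      have h2 : A.card • (((r : ℝ) - μ) * c) ≤
          ∑ i ∈ A, (((n : ℝ) - ((i : ℕ) + 1 : ℝ)) * P.w i - P.w i * ((n : ℝ) - r)) := by
        refine Finset.card_nsmul_le_sum _ _ _ fun i hi => ?_
        have hi1 : (i : ℕ) < μ := (Finset.mem_filter.1 hi).2
        have hi2 : ((i : ℕ) : ℝ) + 1 ≤ μ := by exact_mod_cast hi1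
        have hci : c ≤ P.w i := P.w_antitone (by rw [Fin.le_def]; simp only; omega)
        calc ((r : ℝ) - μ) * c ≤ ((r : ℝ) - μ) * P.w i :=
              mul_le_mul_of_nonneg_left hci (by linarith)
          _ ≤ ((r : ℝ) - ((i : ℕ) + 1)) * P.w i :=
              mul_le_mul_of_nonneg_right (by linarith) (P.w_pos i).le
          _ = _ := by ring
      rw [Finset.card_sdiff_of_subset hAB, hAcard, hBcard, nsmul_eq_mul, Nat.cast_sub hle] at h1
      rw [hAcard, nsmul_eq_mul, Finset.sum_sub_distrib] at h2
      -- The cutoff at half of `n` enters here: `n ≤ 2μ` and `μ ≤ r` give `n - r ≤ μ`.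
      have h3 : ((r : ℝ) - μ) * (c * ((n : ℝ) - r)) ≤ μ * (((r : ℝ) - μ) * c) := by
        have h4 : (n : ℝ) - r ≤ μ := by
          have : (n : ℝ) ≤ r + μ := by exact_mod_cast (by omega : n ≤ r + μ)
          linarith
        nlinarith [mul_le_mul_of_nonneg_left h4 (mul_nonneg (sub_nonneg.2 hle') hc0.le)]
      have h5 := Finset.sum_sdiff (f := fun i => P.w i * ((n : ℝ) - r)) hAB
      linarith

/-! ### Optimal plans on the existing machine -/

theorem savings_eq {p : SchedulingPlan n} (hp : p.machines = P.initial.machines)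
    (T : Finset (Fin n)) :
    P.savings T p = ∑ i ∈ T, P.w i * ((P.initial.start i : ℝ) - p.start i) := by
  simp only [savings, waitingCost, SchedulingPlan.numMachines, hp, sub_self, zero_mul, sub_zero]
  rw [← Finset.sum_sub_distrib]
  exact Finset.sum_congr rfl fun i _ => by ring

/-- A coalition can give up all additional machines without loss when `b` is at least
`machineCostBound`: the users of these machines queue up behind the remaining agents. -/
theorem exists_consolidated (hm : P.initial.numMachines = 1) (hb : P.machineCostBound ≤ P.b)
    {T : Finset (Fin n)} {q : SchedulingPlan n}
    (hq : ∀ i, i ∉ T → q.machine i = P.initial.machine i) :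
    ∃ p : SchedulingPlan n, p.machines = P.initial.machines ∧ (∀ i, p.start i < n) ∧
      (∀ i, i ∉ T → p.predecessors i = q.predecessors i ∧
        p.start i = (q.predecessors i).ncard) ∧ P.savings T q ≤ P.savings T p := by
  obtain ⟨M, hM⟩ := Finset.card_eq_one.1 hm
  have hMi : ∀ i, P.initial.machine i = M := fun i =>
    Finset.mem_singleton.1 (hM ▸ P.initial.machine_mem i)
  -- If the old machine was sold, there are no outsiders and any machine may go first.
  obtain ⟨k, hk, hkT⟩ : ∃ k ∈ q.machines, ∀ i, i ∉ T → q.machine i = k := by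
    by_cases hMq : M ∈ q.machines
    · exact ⟨M, hMq, fun i hi => (hq i hi).trans (hMi i)⟩
    · obtain ⟨k, hk⟩ := q.machines_nonempty
      refine ⟨k, hk, fun i hi => absurd ?_ hMq⟩
      rw [← hMi i, ← hq i hi]
      exact q.machine_mem i
  refine ⟨q.consolidate k M, hM.symm, q.consolidate_start_lt k M, fun i hi =>
    ⟨q.consolidate_predecessors M (hkT i hi), q.consolidate_start_eq M (hkT i hi)⟩, ?_⟩
  set p := q.consolidate k M with hp
  have hpm : p.machines = P.initial.machines := hM.symm
  have hloss : ∑ i ∈ T, P.w i * ((p.start i : ℝ) - q.start i) ≤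
      ((q.machines.card : ℝ) - 1) * P.b := by
    calc ∑ i ∈ T, P.w i * ((p.start i : ℝ) - q.start i)
        ≤ ∑ i ∈ T, if q.machine i = k then 0 else
            P.w i * ((n : ℝ) - (q.users (q.machine i)).card) := by
          refine Finset.sum_le_sum fun i _ => ?_
          split_ifs with hi
          · have h : (p.start i : ℝ) ≤ q.start i := by
              rw [hp, q.consolidate_start_eq M hi]
              exact_mod_cast q.ncard_predecessors_le_start i
            exact mul_nonpos_of_nonneg_of_nonpos (P.w_pos i).le (by linarith)
          · refine mul_le_mul_of_nonneg_left ?_ (P.w_pos i).le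
            have hu : (q.users (q.machine i)).card ≤ n := by
              simpa using (q.users (q.machine i)).card_le_univ
            have h : (p.start i : ℝ) ≤
                ((q.start i + (n - (q.users (q.machine i)).card) : ℕ) : ℝ) := by
              exact_mod_cast q.consolidate_start_le k M i
            rw [Nat.cast_add, Nat.cast_sub hu] at h
            linarith
      _ ≤ ∑ i, if q.machine i = k then 0 else
            P.w i * ((n : ℝ) - (q.users (q.machine i)).card) := by
          refine Finset.sum_le_sum_of_subset_of_nonneg (Finset.subset_univ T) fun i _ _ => ?_
          split_ifs
          · exact le_rfl
          · refine mul_nonneg (P.w_pos i).le (sub_nonneg.2 ?_)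
            exact_mod_cast (by simpa using (q.users (q.machine i)).card_le_univ)
      _ = ∑ l ∈ q.machines, ∑ i ∈ q.users l, if q.machine i = k then 0 else
            P.w i * ((n : ℝ) - (q.users (q.machine i)).card) :=
          (Finset.sum_fiberwise_of_maps_to (fun i _ => q.machine_mem i) _).symm
      _ ≤ ∑ l ∈ q.machines, if l = k then 0 else P.b := by
          refine Finset.sum_le_sum fun l _ => ?_
          have hl : ∀ i ∈ q.users l, q.machine i = l := fun i hi => (Finset.mem_filter.1 hi).2
          split_ifs with hlk
          · exact (Finset.sum_eq_zero fun i hi => if_pos ((hl i hi).trans hlk)).le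
          · rw [Finset.sum_congr rfl fun i hi => by rw [hl i hi, if_neg hlk]]
            exact (P.sum_card_compl_mul_le_machineCostBound _).trans hb
      _ = _ := by
          rw [← Finset.add_sum_erase _ _ hk, if_pos rfl, zero_add,
            Finset.sum_congr rfl fun l hl => if_neg (Finset.ne_of_mem_erase hl),
            Finset.sum_const, Finset.card_erase_of_mem hk, nsmul_eq_mul,
            Nat.cast_sub (Finset.card_pos.2 q.machines_nonempty), Nat.cast_one]
  rw [P.savings_eq hpm T]
  have hsq : P.savings T q = ∑ i ∈ T, P.w i * ((P.initial.start i : ℝ) - q.start i)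
      - ((q.machines.card : ℝ) - 1) * P.b := by
    rw [savings, hm, waitingCost, waitingCost, ← Finset.sum_sub_distrib, Nat.cast_one]
    congr 1
    exact Finset.sum_congr rfl fun i _ => by ring
  have hsum : ∑ i ∈ T, P.w i * ((P.initial.start i : ℝ) - q.start i) =
      ∑ i ∈ T, P.w i * ((P.initial.start i : ℝ) - p.start i) +
      ∑ i ∈ T, P.w i * ((p.start i : ℝ) - q.start i) := by
    rw [← Finset.sum_add_distrib]
    exact Finset.sum_congr rfl fun i _ => by ring
  linarith

theorem exists_consolidated_admissibleSwaps (hm : P.initial.numMachines = 1)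
    (hb : P.machineCostBound ≤ P.b) {T : Finset (Fin n)} {q : SchedulingPlan n}
    (hq : P.AdmissibleSwaps T q) :
    ∃ p : SchedulingPlan n, p.machines = P.initial.machines ∧ (∀ i, p.start i < n) ∧
      P.AdmissibleSwaps T p ∧ P.savings T q ≤ P.savings T p := by
  obtain ⟨p, hpm, hpn, hpT, hps⟩ := P.exists_consolidated hm hb fun i hi => (hq i hi).1
  refine ⟨p, hpm, hpn, fun i hi => ⟨?_, ?_⟩, hps⟩
  · exact Finset.card_le_one.1 hm.le _ (hpm ▸ p.machine_mem i) _ (P.initial.machine_mem i)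
  · rw [(hpT i hi).2]
    exact (q.ncard_predecessors_le_start i).trans (hq i hi).2

/-- Without idle time an outsider starts after exactly as many slots as it has predecessors, so
having no new ones also means not starting later. This lets the core bound for swaps serve both
games. -/
theorem exists_consolidated_admissibleNoSwaps (hm : P.initial.numMachines = 1)
    (hb : P.machineCostBound ≤ P.b) {T : Finset (Fin n)} {q : SchedulingPlan n}
    (hq : P.AdmissibleNoSwaps T q) :
    ∃ p : SchedulingPlan n, p.machines = P.initial.machines ∧ (∀ i, p.start i < n) ∧
      P.AdmissibleNoSwaps T p ∧ P.AdmissibleSwaps T p ∧ P.savings T q ≤ P.savings T p := by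
  obtain ⟨p, hpm, hpn, hpT, hps⟩ := P.exists_consolidated hm hb fun i hi => (hq i hi).1
  have hmach : ∀ i, p.machine i = P.initial.machine i := fun i =>
    Finset.card_le_one.1 hm.le _ (hpm ▸ p.machine_mem i) _ (P.initial.machine_mem i)
  refine ⟨p, hpm, hpn, fun i hi => ⟨hmach i, ?_⟩, fun i hi => ⟨hmach i, ?_⟩, hps⟩
  · rw [(hpT i hi).1]
    exact (hq i hi).2
  · rw [(hpT i hi).2]
    exact (Set.ncard_le_ncard (hq i hi).2).trans (P.initial.ncard_predecessors_le_start i)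

/-- Starting times below `n` leave finitely many values of the savings, so the supremum is attained.
-/
theorem exists_optimal {T : Finset (Fin n)} {Adm : SchedulingPlan n → Prop}
    (hinit : Adm P.initial)
    (h : ∀ q, Adm q → ∃ p : SchedulingPlan n, p.machines = P.initial.machines ∧
      (∀ i, p.start i < n) ∧ Adm p ∧ P.savings T q ≤ P.savings T p) :
    ∃ p : SchedulingPlan n, p.machines = P.initial.machines ∧ Adm p ∧
      P.savings T p = sSup (P.savings T '' {p | Adm p}) ∧
      ∀ q, Adm q → P.savings T q ≤ P.savings T p := by
  set S : Set (SchedulingPlan n) :=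
    {p | p.machines = P.initial.machines ∧ (∀ i, p.start i < n) ∧ Adm p} with hS
  have hfin : (P.savings T '' S).Finite := by
    refine ((Set.Finite.pi' fun _ : Fin n => Set.finite_Iio n).image
      (fun s : Fin n → ℕ => ∑ i ∈ T, P.w i * ((P.initial.start i : ℝ) - s i))).subset ?_
    rintro _ ⟨p, hp, rfl⟩
    exact ⟨p.start, hp.2.1, (P.savings_eq hp.1 T).symm⟩
  have hne : (P.savings T '' S).Nonempty := by
    obtain ⟨p, h1, h2, h3, -⟩ := h _ hinit
    exact ⟨_, p, ⟨h1, h2, h3⟩, rfl⟩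
  obtain ⟨_, ⟨p, hp, rfl⟩, hmax⟩ := Set.exists_max_image _ id hfin hne
  have hopt : ∀ q, Adm q → P.savings T q ≤ P.savings T p := by
    intro q hq
    obtain ⟨p', h1, h2, h3, h4⟩ := h q hq
    exact h4.trans (hmax _ ⟨p', ⟨h1, h2, h3⟩, rfl⟩)
  refine ⟨p, hp.1, hp.2.2, ?_, hopt⟩
  symm
  apply IsGreatest.csSup_eq
  refine ⟨⟨p, hp.2.2, rfl⟩, ?_⟩
  rintro _ ⟨q, hq, rfl⟩
  exact hopt q hq

/-! ### Competitive prices and the core -/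

/-- The competitive price of the time slot `t`. -/
def slotPrice (t : Fin n) : ℝ := ∑ r ∈ Finset.Ici t, P.w r

theorem slotPrice_antitone : Antitone P.slotPrice := fun _ _ h =>
  Finset.sum_le_sum_of_subset_of_nonneg (Finset.Ici_subset_Ici.2 h) fun i _ _ => (P.w_pos i).le

theorem slotPrice_eq_add {s t : Fin n} (h : s ≤ t) :
    P.slotPrice s = ∑ r ∈ Finset.Ico s t, P.w r + P.slotPrice t := by
  rw [slotPrice, slotPrice, ← Finset.sum_union]
  · congr 1
    ext r
    simp only [Finset.mem_Ici, Finset.mem_union, Finset.mem_Ico]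
    constructor
    · intro hr
      rcases lt_or_ge r t with h' | h'
      · exact Or.inl ⟨hr, h'⟩
      · exact Or.inr h'
    · rintro (h' | h')
      · exact h'.1
      · exact h.trans h'
  · refine Finset.disjoint_left.2 fun r hr hr' => ?_
    exact absurd (Finset.mem_Ico.1 hr).2 (not_lt.2 (Finset.mem_Ici.1 hr'))

/-- At the prices `slotPrice`, slot `i` is a cheapest one for agent `i`. -/
theorem cost_own_slot_le (i t : Fin n) :
    P.w i * ((i : ℕ) : ℝ) + P.slotPrice i ≤ P.w i * ((t : ℕ) : ℝ) + P.slotPrice t := by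
  rcases le_total i t with h | h
  · rw [P.slotPrice_eq_add h]
    -- Moving back from slot `i` to `t` saves the weights of agents `i, …, t - 1`, each at most `w
    -- i`, but costs `w i` per step.
    have h1 : ∑ r ∈ Finset.Ico i t, P.w r ≤ (Finset.Ico i t).card • P.w i :=
      Finset.sum_le_card_nsmul _ _ _ fun r hr => P.w_antitone (Finset.mem_Ico.1 hr).1
    rw [Fin.card_Ico, nsmul_eq_mul, Nat.cast_sub h] at h1
    linarith
  · rw [P.slotPrice_eq_add h]
    have h1 : (Finset.Ico t i).card • P.w i ≤ ∑ r ∈ Finset.Ico t i, P.w r :=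
      Finset.card_nsmul_le_sum _ _ _ fun r hr => P.w_antitone (Finset.mem_Ico.1 hr).2.le
    rw [Fin.card_Ico, nsmul_eq_mul, Nat.cast_sub h] at h1
    linarith

/-- All times up to the start of `i` are occupied, and `n` agents have at most `n` starting times.
-/
theorem initial_start_lt (hsa : P.initial.SemiActive)
    (i : Fin n) : P.initial.start i < n := by
  have h : (Finset.range (P.initial.start i + 1)).card ≤
      (Finset.univ.image P.initial.start).card := by
    refine Finset.card_le_card fun t ht => ?_
    rcases Nat.lt_or_eq_of_le (Nat.lt_succ_iff.1 (Finset.mem_range.1 ht)) with h | h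
    · obtain ⟨j, -, hj⟩ := hsa.1 i t h
      exact Finset.mem_image.2 ⟨j, Finset.mem_univ j, hj⟩
    · exact Finset.mem_image.2 ⟨i, Finset.mem_univ i, h.symm⟩
  have h' := h.trans Finset.card_image_le
  simpa using h'

theorem start_bijective (hm : P.initial.numMachines = 1) {p : SchedulingPlan n}
    (hp : p.machines = P.initial.machines) (hpn : ∀ i, p.start i < n) :
    Function.Bijective (fun i => (⟨p.start i, hpn i⟩ : Fin n)) := by
  refine Finite.injective_iff_bijective.1 fun i j hij => ?_
  by_contra hne
  exact p.admissible i j hne (Finset.card_le_one.1 hm.le _ (hp ▸ p.machine_mem i) _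
    (hp ▸ p.machine_mem j)) (Fin.mk.inj_iff.1 hij)

/-- Every agent sells its initial slot and buys the slot it occupies in the optimal queue. -/
def competitiveAllocation (h0 : ∀ i, P.initial.start i < n) (i : Fin n) : ℝ :=
  P.w i * P.initial.start i + P.slotPrice ⟨P.initial.start i, h0 i⟩
    - (P.w i * ((i : ℕ) : ℝ) + P.slotPrice i)

theorem savings_le_sum_competitiveAllocation (hm : P.initial.numMachines = 1)
    (h0 : ∀ i, P.initial.start i < n) {T : Finset (Fin n)} {p : SchedulingPlan n}
    (hp : p.machines = P.initial.machines) (hpn : ∀ i, p.start i < n)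
    (hpT : P.AdmissibleSwaps T p) :
    P.savings T p ≤ ∑ i ∈ T, P.competitiveAllocation h0 i := by
  -- Both queues fill the slots `0, …, n - 1` exactly, so their total prices agree.
  have hsum : ∑ i, P.slotPrice ⟨p.start i, hpn i⟩ =
      ∑ i, P.slotPrice ⟨P.initial.start i, h0 i⟩ :=
    ((P.start_bijective hm hp hpn).sum_comp P.slotPrice).trans
      ((P.start_bijective hm rfl h0).sum_comp P.slotPrice).symm
  have hout : ∑ i ∈ Tᶜ, P.slotPrice ⟨P.initial.start i, h0 i⟩ ≤
      ∑ i ∈ Tᶜ, P.slotPrice ⟨p.start i, hpn i⟩ :=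
    Finset.sum_le_sum fun i hi =>
      P.slotPrice_antitone (Fin.mk_le_mk.2 (hpT i (Finset.mem_compl.1 hi)).2)
  have hin : ∑ i ∈ T, P.slotPrice ⟨p.start i, hpn i⟩ ≤
      ∑ i ∈ T, P.slotPrice ⟨P.initial.start i, h0 i⟩ := by
    rw [← Finset.sum_add_sum_compl T, ← Finset.sum_add_sum_compl T] at hsum
    linarith
  have hbuy : ∑ i ∈ T, P.w i * ((P.initial.start i : ℝ) - p.start i) ≤
      ∑ i ∈ T, (P.competitiveAllocation h0 i
        - (P.slotPrice ⟨P.initial.start i, h0 i⟩ - P.slotPrice ⟨p.start i, hpn i⟩)) := by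
    refine Finset.sum_le_sum fun i _ => ?_
    have := P.cost_own_slot_le i ⟨p.start i, hpn i⟩
    simp only at this
    rw [competitiveAllocation]
    linarith
  rw [Finset.sum_sub_distrib, Finset.sum_sub_distrib] at hbuy
  rw [P.savings_eq hp]
  linarith

/-- The queue on the initial machine in which agents are ordered by decreasing waiting cost. -/
def sortedPlan : SchedulingPlan n where
  machines := P.initial.machines
  machines_nonempty := P.initial.machines_nonempty
  machine := P.initial.machine
  machine_mem := P.initial.machine_mem
  start := fun i => i
  admissible := fun _ _ hij _ h => hij (Fin.ext h)

theorem savings_sortedPlan (hm : P.initial.numMachines = 1) (h0 : ∀ i, P.initial.start i < n) :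
    P.savings Finset.univ P.sortedPlan = ∑ i, P.competitiveAllocation h0 i := by
  have hsum : ∑ i, P.slotPrice ⟨P.initial.start i, h0 i⟩ = ∑ i, P.slotPrice i :=
    (P.start_bijective hm rfl h0).sum_comp P.slotPrice
  rw [P.savings_eq (p := P.sortedPlan) rfl]
  simp only [competitiveAllocation, sortedPlan, mul_sub,
    Finset.sum_sub_distrib, Finset.sum_add_distrib, hsum]
  ring

end RequeueingProblem

theorem theorem4 {n : ℕ} (P : RequeueingProblem n)
    (hm : P.initial.numMachines = 1) (hsa : P.initial.SemiActive)
    (hb : P.machineCostBound ≤ P.b) :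
    -- every coalition has an optimal admissible plan without any new machine
    (∀ T : Finset (Fin n),
      (∃ p, p.machines = P.initial.machines ∧ P.AdmissibleSwaps T p ∧
        P.savings T p = P.gameSwaps T ∧
        ∀ q, P.AdmissibleSwaps T q → P.savings T q ≤ P.savings T p) ∧
      (∃ p, p.machines = P.initial.machines ∧ P.AdmissibleNoSwaps T p ∧
        P.savings T p = P.gameNoSwaps T ∧
        ∀ q, P.AdmissibleNoSwaps T q → P.savings T q ≤ P.savings T p)) ∧
    (valueCore P.gameSwaps).Nonempty ∧ (valueCore P.gameNoSwaps).Nonempty := by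
  have hS : ∀ T : Finset (Fin n), ∃ p : SchedulingPlan n, p.machines = P.initial.machines ∧
      P.AdmissibleSwaps T p ∧ P.savings T p = P.gameSwaps T ∧
      ∀ q, P.AdmissibleSwaps T q → P.savings T q ≤ P.savings T p := fun T =>
    P.exists_optimal (fun i _ => ⟨rfl, le_rfl⟩) fun q hq =>
      P.exists_consolidated_admissibleSwaps hm hb hq
  have hNS : ∀ T : Finset (Fin n), ∃ p : SchedulingPlan n, p.machines = P.initial.machines ∧
      P.AdmissibleNoSwaps T p ∧ P.savings T p = P.gameNoSwaps T ∧
      ∀ q, P.AdmissibleNoSwaps T q → P.savings T q ≤ P.savings T p := fun T =>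
    P.exists_optimal (fun i _ => ⟨rfl, subset_rfl⟩) fun q hq => by
      obtain ⟨p, h1, h2, h3, -, h4⟩ := P.exists_consolidated_admissibleNoSwaps hm hb hq
      exact ⟨p, h1, h2, h3, h4⟩
  have h0 := P.initial_start_lt hsa
  have boundS : ∀ T : Finset (Fin n),
      P.gameSwaps T ≤ ∑ i ∈ T, P.competitiveAllocation h0 i := by
    intro T
    obtain ⟨q, -, hq, hqv, -⟩ := hS T
    -- The optimal plan `q` may still start jobs at `n` or later, where no price is defined;
    -- consolidating again excludes this.
    obtain ⟨p, h1, h2, h3, h4⟩ := P.exists_consolidated_admissibleSwaps hm hb hq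
    exact hqv ▸ h4.trans (P.savings_le_sum_competitiveAllocation hm h0 h1 h2 h3)
  have boundNS : ∀ T : Finset (Fin n),
      P.gameNoSwaps T ≤ ∑ i ∈ T, P.competitiveAllocation h0 i := by
    intro T
    obtain ⟨q, -, hq, hqv, -⟩ := hNS T
    obtain ⟨p, h1, h2, -, h3, h4⟩ := P.exists_consolidated_admissibleNoSwaps hm hb hq
    exact hqv ▸ h4.trans (P.savings_le_sum_competitiveAllocation hm h0 h1 h2 h3)
  refine ⟨fun T => ⟨hS T, hNS T⟩, ⟨P.competitiveAllocation h0, le_antisymm ?_ (boundS _), boundS⟩,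
    ⟨P.competitiveAllocation h0, le_antisymm ?_ (boundNS _), boundNS⟩⟩
  · obtain ⟨q, -, -, hqv, hopt⟩ := hS Finset.univ
    rw [← P.savings_sortedPlan hm h0, ← hqv]
    exact hopt _ fun i hi => absurd (Finset.mem_univ i) hi
  · obtain ⟨q, -, -, hqv, hopt⟩ := hNS Finset.univ
    rw [← P.savings_sortedPlan hm h0, ← hqv]
    exact hopt _ fun i hi => absurd (Finset.mem_univ i) hi
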